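/- A \emph{Cayley group} with generator set $E$ is a group $G$ generated by a subset $E\subseteq G$ all of whose elements are non-trivial involutions ($e\neq 1$, $e^2=1$); its Cayley graph has vertex set $G$ and $e$-labelled edges $\{v,ve\}$ for $v\in G$, $e\in E$. For $\alpha\subseteq E$ let $G_\alpha$ be the subgroup generated by $\alpha$ and let $[v]_\alpha=vG_\alpha$ be the $\alpha$-coset of $v$ (the class of $v$ under the equivalence relation $R_\alpha$ of being connected by edges with labels in $\alpha$). A \emph{coset cycle of length $r\ge 1$} is a sequence $((v_i,\alpha_i))_{i\in\mathbb{Z}/r}$ with $v_i\in G$, $\alpha_i\subseteq E$, such that for all $i\in\mathbb{Z}/r$ one has $v_i^{-1}v_{i+1}\in G_{\alpha_i}$ and $[v_i]_{\alpha_{i-1}\cap\alpha_i}\cap[v_{i+1}]_{\alpha_i\cap\alpha_{i+1}}=\emptyset$. The graph is \emph{coset $n$-acyclic} if it has no coset cycle of length at most $n$. A \emph{coset path of length $\ell\ge 1$} is a sequence $v_1,\alpha_1,v_2,\dots,v_\ell,\alpha_\ell,v_{\ell+1}$ with $v_i\in G$, $\alpha_i\subseteq E$, such that, with $\alpha_0=\alpha_{\ell+1}=\emptyset$,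 for all $1\le i\le\ell$ one has $v_{i+1}\in[v_i]_{\alpha_i}$ and $[v_i]_{\alpha_{i-1}\cap\alpha_i}\cap[v_{i+1}]_{\alpha_i\cap\alpha_{i+1}}=\emptyset$. A set $Q$ of cosets is \emph{$m$-closed} if for every coset path of length $\ell\le m$ with $[v_1]_{\alpha_1}\in Q$ and $[v_{\ell+1}]_{\alpha_\ell}\in Q$, all cosets $[v_i]_{\alpha_i}$, $1<i<\ell$, belong to $Q$. For a set $P$ of cosets, the \emph{convex $m$-closure} $\mathrm{cl}^c_m(P)$ is the intersection of all $m$-closed sets $Q$ of cosets with $Q\supseteq P$. \textbf{Proposition.} Let $E$ be a fixed finite set of generators and let $m\ge 1$. There are functions $f,N:\mathbb{N}\to\mathbb{N}$ (depending only on $E$ and $m$) such that for every $k\in\mathbb{N}$, every Cayley graph $G$ (finite or infinite) with generator set $E$ that is coset $N(k)$-acyclic, and every set $P$ of cosets $[v]_\alpha$ ($v\in G$, $\alpha\subseteq E$) with $|P|\le k$, $$|\mathrm{cl}^c_m(P)|\le f(k).$$ In particular $\mathrm{cl}^c_m(P)$ is finite. -/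

import Mathlib

/-- A Cayley group `G` with generator set `E`: the elements of `E` are (pairwise distinct)
non-trivial involutions of `G` that generate `G`. The Cayley graph has vertex set `G` and an
`e`-labelled edge between `v` and `v * gen e`, for all `v : G` and `e : E`. -/
structure CayleyGroup (E : Type*) (G : Type*) [Group G] where
  gen : E → G
  gen_injective : Function.Injective gen
  gen_ne_one : ∀ e, gen e ≠ 1
  gen_mul_self : ∀ e, gen e * gen e = 1
  closure_range_gen : Subgroup.closure (Set.range gen) = ⊤

namespace CayleyGroup

variable {E : Type*} {G : Type*} [Group G] (C : CayleyGroup E G)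

/-- The subgroup `G_α` generated by the generators in `α`. -/
def subgroup (α : Set E) : Subgroup G := Subgroup.closure (C.gen '' α)

/-- The `α`-coset `[v]_α = v G_α` of a vertex `v`. -/
def coset (v : G) (α : Set E) : Set G := {u | v⁻¹ * u ∈ C.subgroup α}

/-- `v` and `u` are joined by an edge with label `e`. -/
def Edge (e : E) (v u : G) : Prop := u = v * C.gen e

/-- `[v]_α` is the class of `v` under the equivalence relation `R_α`, the (reflexive) transitive
closure of the union of the edge relations with labels in `α`. -/
theorem mem_coset_iff_reflTransGen (v u : G) (α : Set E) :
    u ∈ C.coset v α ↔ Relation.ReflTransGen (fun x y => ∃ e ∈ α, C.Edge e x y) v u := by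
  constructor
  · intro h
    have key : ∀ g ∈ C.subgroup α, ∀ x : G,
        Relation.ReflTransGen (fun x y => ∃ e ∈ α, C.Edge e x y) x (x * g) := by
      intro g hg
      refine Subgroup.closure_induction (fun g hg x => ?_) (fun x => ?_)
        (fun a b _ _ ha hb x => ?_) (fun a _ ha x => ?_) hg
      · obtain ⟨e, he, rfl⟩ := hg
        exact Relation.ReflTransGen.single ⟨e, he, rfl⟩
      · rw [mul_one]
      · rw [← mul_assoc]
        exact (ha x).trans (hb (x * a))
      · have hs : Std.Symm (fun x y => ∃ e ∈ α, C.Edge e x y) := by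
          constructor
          rintro x y ⟨e, he, rfl⟩
          exact ⟨e, he, by simp [Edge, mul_assoc, C.gen_mul_self]⟩
        have h1 := ha (x * a⁻¹)
        rw [inv_mul_cancel_right] at h1
        exact (Relation.ReflTransGen.stdSymm (r := fun x y => ∃ e ∈ α, C.Edge e x y)).symm _ _ h1
    have h2 := key _ h v
    rwa [mul_inv_cancel_left] at h2
  · intro h
    induction h with
    | refl =>
      change v⁻¹ * v ∈ C.subgroup α
      rw [inv_mul_cancel]
      exact one_mem _
    | tail _ hbc ih =>
      obtain ⟨e, he, rfl⟩ := hbc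
      change v⁻¹ * (_ * C.gen e) ∈ C.subgroup α
      rw [← mul_assoc]
      exact mul_mem ih (Subgroup.subset_closure ⟨e, he, rfl⟩)

/-- The set of all cosets, the union over `α ⊆ E` of the quotients `V / R_α`. -/
def cosets : Set (Set G) := {X | ∃ (v : G) (α : Set E), X = C.coset v α}

/-- `(v i, α i)`, `i ∈ ℤ/r`, is a coset cycle of length `r`, where `r ≥ 1`. -/
def IsCosetCycle (r : ℕ) (v : ZMod r → G) (α : ZMod r → Set E) : Prop :=
  1 ≤ r ∧ ∀ i : ZMod r,
    (v i)⁻¹ * v (i + 1) ∈ C.subgroup (α i) ∧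
    C.coset (v i) (α (i - 1) ∩ α i) ∩ C.coset (v (i + 1)) (α i ∩ α (i + 1)) = ∅

/-- Coset `n`-acyclicity: there are no coset cycles of length up to `n`. -/
def CosetAcyclic (n : ℕ) : Prop :=
  ∀ r ≤ n, ∀ (v : ZMod r → G) (α : ZMod r → Set E), ¬ C.IsCosetCycle r v α

/-- `v 1, α 1, v 2, α 2, …, α ℓ, v (ℓ + 1)` is a coset path of length `ℓ ≥ 1`, with the convention
`α 0 = α (ℓ + 1) = ∅`; all other values of `v` and `α` are irrelevant. -/
def IsCosetPath (ℓ : ℕ) (v : ℕ → G) (α : ℕ → Set E) : Prop :=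
  1 ≤ ℓ ∧ α 0 = ∅ ∧ α (ℓ + 1) = ∅ ∧ ∀ i, 1 ≤ i → i ≤ ℓ →
    v (i + 1) ∈ C.coset (v i) (α i) ∧
    C.coset (v i) (α (i - 1) ∩ α i) ∩ C.coset (v (i + 1)) (α i ∩ α (i + 1)) = ∅

/-- A set `Q` of cosets is `m`-closed if every coset path of length at most `m` between two cosets
in `Q` has all its inner cosets in `Q`. -/
def IsMClosed (m : ℕ) (Q : Set (Set G)) : Prop :=
  ∀ (ℓ : ℕ) (v : ℕ → G) (α : ℕ → Set E), ℓ ≤ m → C.IsCosetPath ℓ v α →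
    C.coset (v 1) (α 1) ∈ Q → C.coset (v (ℓ + 1)) (α ℓ) ∈ Q →
    ∀ i, 1 < i → i < ℓ → C.coset (v i) (α i) ∈ Q

/-- The convex `m`-closure of a set `P` of cosets. -/
def convexClosure (m : ℕ) (P : Set (Set G)) : Set (Set G) :=
  ⋂₀ {Q | P ⊆ Q ∧ Q ⊆ C.cosets ∧ C.IsMClosed m Q}

end CayleyGroup

/-! The claim becomes one about chordless paths in the graph `cosetGraph` of cosets, where distinct
intersecting cosets are adjacent. Acyclicity up to `N` forbids chordless cycles of length 4 to `N`
(`chordalUpTo_cosetGraph`), gives a Helly property that bounds cliques by the number of subsets of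
`E` (`cliqueFree_cosetGraph`), and makes coset paths chordless (`isInducedPath_of_isCosetPath`).

In a chordal graph of bounded clique number, a graph generated from `k` vertices by chordless paths
of length at most `m` has bounded size (`exists_bound_of_pathGenerated`, by induction on the clique
bound). The engine is Dirac's argument: a component outside a ball attaches to the ball along a
clique, so a path cannot enter it and come back, and every such component must contain a generator.
This bounds degrees, since a neighbourhood is generated by few vertices and has smaller cliques, and
it bounds the distance to the generators (`exists_mem_walkBall`).

Chordality is only known up to length `N`, so `exists_pathClosed_superset` adds one path at a time:
all intermediate sets are too small to contain a longer chordless cycle. -/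

theorem Set.encard_biUnion_le_mul {ι V : Type*} {T : Set ι} {s : ι → Set V} {a b : ℕ}
    (hT : T.encard ≤ a) (hs : ∀ i ∈ T, (s i).encard ≤ b) :
    (⋃ i ∈ T, s i).encard ≤ (a * b : ℕ) := by
  have hfin : T.Finite := Set.finite_of_encard_le_coe hT
  have hcard : hfin.toFinset.card ≤ a := by
    rw [hfin.encard_eq_coe_toFinset_card] at hT
    exact_mod_cast hT
  have hU : (⋃ i ∈ T, s i) = ⋃ i ∈ hfin.toFinset, s i := by simp
  rw [hU]
  refine (Finset.set_encard_biUnion_le _ _).trans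
    ((Finset.sum_le_sum fun i hi => hs i (hfin.mem_toFinset.1 hi)).trans ?_)
  rw [Finset.sum_const, nsmul_eq_mul]
  exact_mod_cast Nat.mul_le_mul_right _ hcard

/-! ### Chordless paths and clique separators -/

namespace SimpleGraph

section InducedPaths

variable {V : Type*} (G : SimpleGraph V)

/-- `p 0, …, p l` is a chordless path. -/
def IsInducedPath (p : ℕ → V) (l : ℕ) : Prop :=
  ∀ i j, i < j → j ≤ l → p i ≠ p j ∧ (G.Adj (p i) (p j) ↔ j = i + 1)

/-- `c 0, …, c (n - 1)` is a chordless cycle. -/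
def IsInducedCycle (c : ℕ → V) (n : ℕ) : Prop :=
  ∀ i j, i < j → j < n →
    c i ≠ c j ∧ (G.Adj (c i) (c j) ↔ j = i + 1 ∨ (i = 0 ∧ j + 1 = n))

/-- There are no chordless cycles of length between `4` and `N`. -/
def ChordalUpTo (N : ℕ) : Prop :=
  ∀ c n, 4 ≤ n → n ≤ N → ¬ G.IsInducedCycle c n

/-- `Q` contains all chordless paths of length at most `m` between its elements. -/
def PathClosed (m : ℕ) (Q : Set V) : Prop :=
  ∀ p l, l ≤ m → G.IsInducedPath p l → p 0 ∈ Q → p l ∈ Q → ∀ i ≤ l, p i ∈ Q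

/-- The only path-closed set containing `P` is the whole vertex set. -/
def PathGenerated (m : ℕ) (P : Set V) : Prop :=
  ∀ Q, P ⊆ Q → G.PathClosed m Q → ∀ x, x ∈ Q

/-- The graph on `V` with those edges of `G` that have both ends in `S`. -/
def within (S : Set V) : SimpleGraph V where
  Adj a b := G.Adj a b ∧ a ∈ S ∧ b ∈ S
  symm := ⟨fun _ _ h => ⟨h.1.symm, h.2.2, h.2.1⟩⟩
  loopless := ⟨fun _ h => G.loopless.irrefl _ h.1⟩

/-- The ball of radius `r` about `x`. -/
def walkBall (x : V) (r : ℕ) : Set V := {y | ∃ w : G.Walk x y, w.length ≤ r}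

variable {G}

theorem within_mono {S T : Set V} (h : S ⊆ T) : G.within S ≤ G.within T :=
  fun _ _ hab => ⟨hab.1, h hab.2.1, h hab.2.2⟩

theorem reachable_within_of_adj {S : Set V} {a b : V} (h : G.Adj a b) (ha : a ∈ S) (hb : b ∈ S) :
    (G.within S).Reachable a b :=
  Adj.reachable (G := G.within S) ⟨h, ha, hb⟩

theorem mem_of_reachable_within {S : Set V} {a b : V} (ha : a ∈ S)
    (h : (G.within S).Reachable a b) : b ∈ S := by
  rw [reachable_iff_reflTransGen] at h
  cases h with
  | refl => exact ha
  | tail _ h => exact h.2.2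

theorem reachable_within_component {S : Set V} {a b : V} (h : (G.within S).Reachable a b) :
    (G.within {z | (G.within S).Reachable a z}).Reachable a b := by
  have h' := h
  rw [reachable_iff_reflTransGen] at h
  induction h with
  | refl => exact Reachable.refl _
  | @tail c d h1 h2 ih =>
    have hc : (G.within S).Reachable a c := (reachable_iff_reflTransGen _ _).2 h1
    exact (ih hc).trans (reachable_within_of_adj h2.1 hc h')

/-- Splicing a shortcut `q` into a geodesic cannot shorten it. Hence geodesics have no chords. -/
theorem Walk.sub_le_length_of_length_eq_dist {a b : V} (w : G.Walk a b)
    (hw : w.length = G.dist a b) {i j : ℕ} (hj : j ≤ w.length)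
    (q : G.Walk (w.getVert i) (w.getVert j)) : j ≤ i + q.length := by
  have h := dist_le ((w.take i).append (q.append (w.drop j)))
  simp only [Walk.length_append, Walk.take_length, Walk.drop_length] at h
  rw [← hw] at h
  omega

theorem exists_isInducedPath_of_reachable {S : Set V} {a b : V} (hab : a ≠ b)
    (h : (G.within S).Reachable a b) :
    ∃ p l, p 0 = a ∧ p l = b ∧ G.IsInducedPath p l ∧ ∀ i ≤ l, p i ∈ S := by
  obtain ⟨w, hw⟩ := h.exists_walk_length_eq_dist
  have hpos : 0 < w.length := by
    rcases Nat.eq_zero_or_pos w.length with h0 | h0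
    · exact absurd (Walk.eq_of_length_eq_zero h0) hab
    · exact h0
  have hS : ∀ i ≤ w.length, w.getVert i ∈ S := by
    intro i hi
    rcases Nat.lt_or_ge i w.length with h1 | h1
    · exact (w.adj_getVert_succ h1).2.1
    · have : i = (w.length - 1) + 1 := by omega
      rw [this]
      exact (w.adj_getVert_succ (by omega)).2.2
  refine ⟨w.getVert, w.length, w.getVert_zero, w.getVert_length, ?_, hS⟩
  intro i j hij hj
  refine ⟨fun heq => ?_, fun hadj => ?_, ?_⟩
  · have := w.sub_le_length_of_length_eq_dist hw hj (Walk.nil.copy rfl heq)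
    simp at this
    omega
  · have hadj' : (G.within S).Adj (w.getVert i) (w.getVert j) :=
      ⟨hadj, hS i (by omega), hS j hj⟩
    have := w.sub_le_length_of_length_eq_dist hw hj (Walk.cons hadj' Walk.nil)
    simp at this
    omega
  · rintro rfl
    exact (w.adj_getVert_succ (by omega)).1

/-- If `x` and `y` were not adjacent, chordless paths joining them through `A` and through `B` would
close up to a chordless cycle of length at least 4. -/
theorem adj_of_separates (hG : ∀ N, G.ChordalUpTo N) {A B : Set V}
    (hAB : ∀ a ∈ A, ∀ b ∈ B, a ≠ b ∧ ¬ G.Adj a b) {x y : V} (hxy : x ≠ y)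
    (hA : (G.within (A ∪ {x, y})).Reachable x y)
    (hB : (G.within (B ∪ {x, y})).Reachable x y) : G.Adj x y := by
  by_contra hadj
  obtain ⟨p, l, hp0, hpl, hp, hpS⟩ := exists_isInducedPath_of_reachable hxy hA
  obtain ⟨q, k, hq0, hqk, hq, hqS⟩ := exists_isInducedPath_of_reachable hxy hB
  have two_le : ∀ (p : ℕ → V) (l : ℕ), p 0 = x → p l = y → G.IsInducedPath p l → 2 ≤ l := by
    intro p l h0 hl h
    by_contra hlt
    have : l = 0 ∨ l = 1 := by omega
    rcases this with rfl | rfl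
    · exact hxy (h0.symm.trans hl)
    · have := ((h 0 1 (by omega) le_rfl).2).2 rfl
      rw [h0, hl] at this
      exact hadj this
  have interior : ∀ (S : Set V) (p : ℕ → V) (l : ℕ), p 0 = x → p l = y →
      G.IsInducedPath p l → (∀ i ≤ l, p i ∈ S ∪ {x, y}) → ∀ i, 0 < i → i < l → p i ∈ S := by
    intro S p l h0 hl h hS i hi hil
    rcases hS i hil.le with h1 | h1 | h1
    · exact h1
    · exact absurd (h0.trans h1.symm) (h 0 i hi hil.le).1
    · exact absurd (Set.mem_singleton_iff.1 h1 |>.trans hl.symm) (h i l hil le_rfl).1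
  have hl2 := two_le p l hp0 hpl hp
  have hk2 := two_le q k hq0 hqk hq
  have hpA := interior A p l hp0 hpl hp hpS
  have hqB := interior B q k hq0 hqk hq hqS
  -- The cycle runs along `p` from `x` to `y` and returns along `q`.
  refine hG (l + k) (fun t => if t ≤ l then p t else q (l + k - t)) (l + k) (by omega) le_rfl ?_
  intro i j hij hj
  dsimp only
  rcases le_or_gt j l with hjl | hjl
  · rw [if_pos (by omega), if_pos hjl]
    refine ⟨(hp i j hij hjl).1, (hp i j hij hjl).2.trans ?_⟩
    omega
  rcases le_or_gt i l with hil | hil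
  · rw [if_pos hil, if_neg (by omega)]
    rcases Nat.eq_zero_or_pos i with rfl | hi0
    · rw [hp0, ← hq0]
      have := hq 0 (l + k - j) (by omega) (by omega)
      refine ⟨this.1, this.2.trans ?_⟩
      omega
    rcases eq_or_lt_of_le hil with rfl | hil
    · rw [hpl, ← hqk]
      have := hq (i + k - j) k (by omega) (by omega)
      refine ⟨this.1.symm, (G.adj_comm _ _).trans (this.2.trans ?_)⟩
      omega
    · have := hAB _ (hpA i hi0 hil) _ (hqB (l + k - j) (by omega) (by omega))
      refine ⟨this.1, iff_of_false this.2 ?_⟩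
      omega
  · rw [if_neg (by omega), if_neg (by omega)]
    have := hq (l + k - j) (l + k - i) (by omega) (by omega)
    refine ⟨this.1.symm, (G.adj_comm _ _).trans (this.2.trans ?_)⟩
    omega

/-! ### Balls -/

theorem mem_walkBall_self (x : V) (r : ℕ) : x ∈ G.walkBall x r :=
  ⟨Walk.nil, Nat.zero_le r⟩

theorem walkBall_mono (x : V) {r s : ℕ} (h : r ≤ s) : G.walkBall x r ⊆ G.walkBall x s :=
  fun _ ⟨w, hw⟩ => ⟨w, hw.trans h⟩

theorem mem_walkBall_comm {x y : V} {r : ℕ} : y ∈ G.walkBall x r ↔ x ∈ G.walkBall y r :=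
  ⟨fun ⟨w, hw⟩ => ⟨w.reverse, by simpa using hw⟩, fun ⟨w, hw⟩ => ⟨w.reverse, by simpa using hw⟩⟩

theorem mem_walkBall_succ_of_adj {x y z : V} {r : ℕ} (hy : y ∈ G.walkBall x r)
    (h : G.Adj y z) : z ∈ G.walkBall x (r + 1) := by
  obtain ⟨w, hw⟩ := hy
  exact ⟨w.concat h, by simpa using hw⟩

theorem mem_walkBall_succ {x y : V} {r : ℕ} (hy : y ∈ G.walkBall x (r + 1)) :
    y ∈ G.walkBall x r ∨ ∃ z ∈ G.walkBall x r, G.Adj z y := by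
  obtain ⟨w, hw⟩ := mem_walkBall_comm.1 hy
  cases w with
  | nil => exact Or.inl (mem_walkBall_self _ _)
  | cons h q =>
    refine Or.inr ⟨_, mem_walkBall_comm.1 ⟨q, ?_⟩, h.symm⟩
    simpa using hw

theorem reachable_within_walkBall {x : V} {r : ℕ} : ∀ {y : V}, y ∈ G.walkBall x r →
    (G.within (G.walkBall x r)).Reachable x y := by
  induction r with
  | zero =>
    rintro y ⟨w, hw⟩
    obtain rfl := Walk.eq_of_length_eq_zero (Nat.le_zero.1 hw)
    exact Reachable.refl _
  | succ r ih =>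
    intro y hy
    have hmono := within_mono (G := G) (walkBall_mono (G := G) x (Nat.le_succ r))
    rcases mem_walkBall_succ hy with h | ⟨z, hz, hzy⟩
    · exact (ih h).mono hmono
    · exact ((ih hz).mono hmono).trans
        (reachable_within_of_adj hzy (walkBall_mono x (Nat.le_succ r) hz) hy)

theorem mem_walkBall_one {x y : V} : y ∈ G.walkBall x 1 ↔ y = x ∨ G.Adj x y := by
  constructor
  · rintro ⟨w, hw⟩
    cases w with
    | nil => exact Or.inl rfl
    | cons h q =>
      obtain rfl := Walk.eq_of_length_eq_zero (p := q) (by simpa using hw)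
      exact Or.inr h
  · rintro (rfl | h)
    · exact mem_walkBall_self _ _
    · exact ⟨Walk.cons h Walk.nil, by simp⟩

theorem encard_walkBall_le {d : ℕ} (hd : ∀ u, (G.neighborSet u).encard ≤ d) (r : ℕ) :
    ∀ x, (G.walkBall x r).encard ≤ ((d + 1) ^ r : ℕ) := by
  induction r with
  | zero =>
    intro x
    have : G.walkBall x 0 ⊆ {x} := by
      rintro y ⟨w, hw⟩
      exact (Walk.eq_of_length_eq_zero (Nat.le_zero.1 hw)).symm
    simpa using Set.encard_le_encard this
  | succ r ih =>
    intro x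
    have hsub : G.walkBall x (r + 1) ⊆ ⋃ z ∈ insert x (G.neighborSet x), G.walkBall z r := by
      rintro y ⟨w, hw⟩
      cases w with
      | nil => exact Set.mem_biUnion (Set.mem_insert _ _) (mem_walkBall_self _ _)
      | cons h q => exact Set.mem_biUnion (Set.mem_insert_of_mem _ h) ⟨q, by simpa using hw⟩
    have hcard : (insert x (G.neighborSet x)).encard ≤ (d + 1 : ℕ) :=
      (Set.encard_insert_le _ _).trans (by push_cast; gcongr; exact hd x)
    rw [pow_succ']
    exact (Set.encard_le_encard hsub).trans (Set.encard_biUnion_le_mul hcard fun z _ => ih z)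

end InducedPaths

end SimpleGraph

/-! ### Size bounds in chordal graphs -/

namespace SimpleGraph

section Bound

variable {V : Type*} {G : SimpleGraph V}

theorem exists_gap_around {R : ℕ → Prop} {i l : ℕ} (h0 : R 0) (hl : R l) (hil : i ≤ l)
    (hi : ¬ R i) : ∃ j j', j < i ∧ i < j' ∧ j' ≤ l ∧ R j ∧ R j' ∧ ∀ t, j < t → t < j' → ¬ R t := by
  classical
  have hex : ∃ t, i ≤ t ∧ R t := ⟨l, hil, hl⟩
  have hj : R (Nat.findGreatest R i) := Nat.findGreatest_spec (Nat.zero_le i) h0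
  have hj' := Nat.find_spec hex
  refine ⟨Nat.findGreatest R i, Nat.find hex, ?_, ?_, Nat.find_min' hex ⟨hil, hl⟩, hj, hj'.2, ?_⟩
  · exact lt_of_le_of_ne (Nat.findGreatest_le i) fun h => hi (h ▸ hj)
  · exact lt_of_le_of_ne hj'.1 fun h => hi (h.symm ▸ hj'.2)
  · intro t h1 h2 ht
    rcases le_or_gt t i with h | h
    · exact Nat.findGreatest_is_greatest h1 h ht
    · exact Nat.find_min hex h2 ⟨h.le, ht⟩

/-- An excursion of a path out of `Q` begins and ends at distinct boundary vertices of `Q`; their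
adjacency is a chord. -/
theorem pathClosed_of_boundary {m : ℕ} {Q : Set V}
    (h : ∀ q ∈ Q, ∀ q' ∈ Q, q ≠ q' → ∀ z ∉ Q, ∀ z' ∉ Q, G.Adj q z → G.Adj q' z' → G.Adj q q') :
    G.PathClosed m Q := by
  intro p l _ hp h0 hl i hi
  by_contra hpi
  obtain ⟨j, j', hji, hij', hj'l, hj, hj', hgap⟩ :=
    exists_gap_around (R := fun t => p t ∈ Q) h0 hl hi hpi
  have hjj' := hp j j' (by omega) hj'l
  have h1 := (hp j (j + 1) (by omega) (by omega)).2.2 rfl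
  have h2 := (hp (j' - 1) j' (by omega) (by omega)).2.2 (by omega)
  have := hjj'.2.1 (h _ hj _ hj' hjj'.1 _ (hgap (j + 1) (by omega) (by omega)) _
    (hgap (j' - 1) (by omega) (by omega)) h1 h2.symm)
  omega

/-- The component of `y` outside the larger ball and the ball of radius `r` are connected, disjoint
and without edges between them. Each attaching vertex has neighbours in both, so `adj_of_separates`
applies. -/
theorem adj_of_adj_component (hG : ∀ N, G.ChordalUpTo N) {x : V} {r : ℕ} {y : V}
    (hy : y ∉ G.walkBall x (r + 1)) {n₁ n₂ c₁ c₂ : V} (hne : n₁ ≠ n₂)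
    (hn₁ : n₁ ∈ G.walkBall x (r + 1)) (hn₂ : n₂ ∈ G.walkBall x (r + 1))
    (hc₁ : (G.within (G.walkBall x (r + 1))ᶜ).Reachable y c₁)
    (hc₂ : (G.within (G.walkBall x (r + 1))ᶜ).Reachable y c₂)
    (h₁ : G.Adj n₁ c₁) (h₂ : G.Adj n₂ c₂) : G.Adj n₁ n₂ := by
  have hC : ∀ z, (G.within (G.walkBall x (r + 1))ᶜ).Reachable y z → z ∉ G.walkBall x (r + 1) :=
    fun z hz => mem_of_reachable_within (S := (G.walkBall x (r + 1))ᶜ) hy hz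
  have hB : ∀ n c, n ∈ G.walkBall x (r + 1) →
      (G.within (G.walkBall x (r + 1))ᶜ).Reachable y c → G.Adj n c →
      ∃ z ∈ G.walkBall x r, G.Adj z n := by
    intro n c hn hc h
    rcases mem_walkBall_succ hn with h' | h'
    · exact absurd (mem_walkBall_succ_of_adj h' h) (hC c hc)
    · exact h'
  obtain ⟨b₁, hb₁, hbn₁⟩ := hB _ _ hn₁ hc₁ h₁
  obtain ⟨b₂, hb₂, hbn₂⟩ := hB _ _ hn₂ hc₂ h₂
  refine adj_of_separates hG
    (A := {z | (G.within (G.walkBall x (r + 1))ᶜ).Reachable y z}) (B := G.walkBall x r)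
    ?_ hne ?_ ?_
  · intro a ha b hb
    refine ⟨?_, fun hab => hC a ha (mem_walkBall_succ_of_adj hb hab.symm)⟩
    rintro rfl
    exact hC a ha (walkBall_mono x (Nat.le_succ r) hb)
  · have hm := within_mono (G := G) (S := {z | (G.within (G.walkBall x (r + 1))ᶜ).Reachable y z})
      (T := {z | (G.within (G.walkBall x (r + 1))ᶜ).Reachable y z} ∪ {n₁, n₂})
      Set.subset_union_left
    have h3 := ((reachable_within_component hc₁).symm.trans
      (reachable_within_component hc₂)).mono hm
    exact (reachable_within_of_adj h₁ (by simp) (Or.inl hc₁)).trans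
      (h3.trans (reachable_within_of_adj h₂.symm (Or.inl hc₂) (by simp)))
  · have hm := within_mono (G := G) (S := G.walkBall x r) (T := G.walkBall x r ∪ {n₁, n₂})
      Set.subset_union_left
    have h3 := ((reachable_within_walkBall hb₁).symm.trans (reachable_within_walkBall hb₂)).mono hm
    exact (reachable_within_of_adj hbn₁.symm (by simp) (Or.inl hb₁)).trans
      (h3.trans (reachable_within_of_adj hbn₂ (Or.inl hb₂) (by simp)))

/-- A component without generators could be deleted: its complement is path-closed because the
component attaches along a clique. -/
theorem PathGenerated.exists_reachable (hG : ∀ N, G.ChordalUpTo N) {m : ℕ} {P : Set V}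
    (hP : G.PathGenerated m P) {x : V} {r : ℕ} {y : V} (hy : y ∉ G.walkBall x (r + 1)) :
    ∃ p ∈ P, (G.within (G.walkBall x (r + 1))ᶜ).Reachable y p := by
  by_contra hcon
  push Not at hcon
  refine hP {z | ¬ (G.within (G.walkBall x (r + 1))ᶜ).Reachable y z} hcon
    (pathClosed_of_boundary ?_) y (Reachable.refl _)
  have hball : ∀ q z, ¬ (G.within (G.walkBall x (r + 1))ᶜ).Reachable y q →
      (G.within (G.walkBall x (r + 1))ᶜ).Reachable y z → G.Adj q z →
      q ∈ G.walkBall x (r + 1) := by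
    intro q z hq hz h
    by_contra hqb
    refine hq (hz.trans (reachable_within_of_adj h.symm ?_ hqb))
    exact mem_of_reachable_within (S := (G.walkBall x (r + 1))ᶜ) hy hz
  intro q hq q' hq' hne z hz z' hz' h h'
  simp only [Set.mem_ofPred_eq, not_not] at hq hq' hz hz'
  exact adj_of_adj_component hG hy hne (hball _ _ hq hz h) (hball _ _ hq' hz' h') hz hz' h h'

theorem IsClique.encard_le {s : Set V} {n : ℕ} (hs : G.IsClique s) (hn : G.CliqueFree n) :
    s.encard ≤ n := by
  by_contra hlt
  obtain ⟨t, ht, htn⟩ := Set.exists_subset_encard_eq (not_le.1 hlt).le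
  have hfin : t.Finite := Set.finite_of_encard_eq_coe htn
  refine hn hfin.toFinset ⟨?_, ?_⟩
  · rw [hfin.coe_toFinset]
    exact hs.subset ht
  · rw [hfin.encard_eq_coe_toFinset_card] at htn
    exact_mod_cast htn

/-- Vertices at distance one from `u` with a neighbour at distance two have a bounded number. -/
theorem PathGenerated.encard_border_le (hG : ∀ N, G.ChordalUpTo N) {m k n : ℕ}
    (hn : G.CliqueFree n) {P : Set V} (hPk : P.encard ≤ k) (hP : G.PathGenerated m P) (u : V) :
    {z | z ∈ G.walkBall u 1 ∧ ∃ y ∉ G.walkBall u 1, G.Adj z y}.encard ≤ (k * n : ℕ) := by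
  refine (Set.encard_le_encard ?_).trans (Set.encard_biUnion_le_mul hPk
    (s := fun p => {z | z ∈ G.walkBall u 1 ∧ ∃ y ∉ G.walkBall u 1, G.Adj z y ∧
      (G.within (G.walkBall u 1)ᶜ).Reachable y p}) (b := n) ?_)
  · rintro z ⟨hz, y, hy, hzy⟩
    obtain ⟨p, hp, h⟩ := hP.exists_reachable hG (r := 0) hy
    exact Set.mem_biUnion hp ⟨hz, y, hy, hzy, h⟩
  -- Border vertices sharing the same `p` all attach to the component of `p`, so they form a clique.
  · intro p _
    refine IsClique.encard_le ?_ hn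
    rintro z ⟨hz, y, hy, hzy, h⟩ z' ⟨hz', y', hy', hzy', h'⟩ hne
    exact adj_of_adj_component hG (r := 0) hy hne hz hz' (Reachable.refl _) (h.trans h'.symm)
      hzy hzy'

theorem IsInducedPath.segment {p : ℕ → V} {l : ℕ} (hp : G.IsInducedPath p l) {S : Set V}
    {j k : ℕ} (hjk : j + k ≤ l) (hS : ∀ t ≤ k, p (j + t) ∈ S) :
    (G.induce S).IsInducedPath (fun t => ⟨p (j + min t k), hS _ (min_le_right _ _)⟩) k := by
  intro a b hab hb
  have h := hp (j + a) (j + b) (by omega) (by omega)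
  have ha' : min a k = a := by omega
  have hb' : min b k = b := by omega
  simp only [ne_eq, Subtype.mk.injEq, comap_adj, Function.Embedding.subtype_apply, ha', hb']
  refine ⟨h.1, h.2.trans ?_⟩
  omega

theorem IsInducedCycle.of_induce {S : Set V} {c : ℕ → S} {n : ℕ}
    (hc : (G.induce S).IsInducedCycle c n) : G.IsInducedCycle (fun t => (c t : V)) n :=
  fun i j hij hj => ⟨fun h => (hc i j hij hj).1 (Subtype.ext h), (hc i j hij hj).2⟩

theorem ChordalUpTo.induce {N : ℕ} (hG : G.ChordalUpTo N) (S : Set V) :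
    (G.induce S).ChordalUpTo N :=
  fun _ n h4 hn hc => hG _ n h4 hn hc.of_induce

/-- A path-closed `Q` in the neighbourhood extends to `V` by adding all non-neighbours of `u`. A
path leaving the extension passes only through neighbours of `u` that are not border vertices, so
this excursion stays in the neighbourhood. -/
theorem PathGenerated.induce_neighborSet {m : ℕ} {P : Set V} (hP : G.PathGenerated m P) (u : V) :
    (G.induce (G.neighborSet u)).PathGenerated m
      {z | (z : V) ∈ P ∨ ∃ y ∉ G.walkBall u 1, G.Adj z y} := by
  intro Q hPQ hQ x
  suffices h : (x : V) ∈ {v | ∀ hv : v ∈ G.neighborSet u, (⟨v, hv⟩ : G.neighborSet u) ∈ Q} from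
    h x.2
  refine hP {v | ∀ hv : v ∈ G.neighborSet u, (⟨v, hv⟩ : G.neighborSet u) ∈ Q}
    (fun v hv hvu => hPQ (Or.inl hv)) ?_ x
  intro p l hlm hp h0 hl i hi
  by_contra hpi
  obtain ⟨j, j', hji, hij', hj'l, hj, hj', hgap⟩ := exists_gap_around
    (R := fun t => p t ∈ {v | ∀ hv : v ∈ G.neighborSet u, (⟨v, hv⟩ : G.neighborSet u) ∈ Q})
    h0 hl hi hpi
  have hinner : ∀ t, j < t → t < j' →
      G.Adj u (p t) ∧ ∀ y, G.Adj (p t) y → y = u ∨ G.Adj u y := by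
    intro t h1 h2
    have := hgap t h1 h2
    simp only [Set.mem_ofPred_eq, not_forall] at this
    obtain ⟨hv, hvQ⟩ := this
    refine ⟨hv, fun y hy => ?_⟩
    rw [← mem_walkBall_one]
    by_contra hyb
    exact hvQ (hPQ (Or.inr ⟨y, hyb, hy⟩))
  have hadj : ∀ t, t + 1 ≤ l → G.Adj (p t) (p (t + 1)) :=
    fun t ht => (hp t (t + 1) (by omega) ht).2.2 rfl
  -- The end of the gap is not `u`: otherwise the vertex two steps further on would equal `u` or be
  -- joined to it by a chord.
  have hjN : G.Adj u (p j) := by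
    rcases (hinner (j + 1) (by omega) (by omega)).2 _ (hadj j (by omega)).symm with h | h
    · exfalso
      rcases (hinner (j + 1) (by omega) (by omega)).2 _ (hadj (j + 1) (by omega)) with h' | h'
      · exact (hp j (j + 1 + 1) (by omega) (by omega)).1 (h.trans h'.symm)
      · have := (hp j (j + 1 + 1) (by omega) (by omega)).2.1 (by rwa [h])
        omega
    · exact h
  have hj'N : G.Adj u (p j') := by
    obtain ⟨s, rfl⟩ : ∃ s, j' = s + 1 + 1 := ⟨j' - 2, by omega⟩
    rcases (hinner (s + 1) (by omega) (by omega)).2 _ (hadj (s + 1) (by omega)) with h | h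
    · exfalso
      rcases (hinner (s + 1) (by omega) (by omega)).2 _ (hadj s (by omega)).symm with h' | h'
      · exact (hp s (s + 1 + 1) (by omega) (by omega)).1 (h'.trans h.symm)
      · have := (hp s (s + 1 + 1) (by omega) (by omega)).2.1 (by rw [h]; exact h'.symm)
        omega
    · exact h
  have hS : ∀ t ≤ j' - j, p (j + t) ∈ G.neighborSet u := by
    intro t ht
    rcases Nat.eq_zero_or_pos t with rfl | h1
    · exact hjN
    rcases eq_or_lt_of_le ht with rfl | h2
    · rwa [show j + (j' - j) = j' by omega]
    · exact (hinner (j + t) (by omega) (by omega)).1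
  have hseg := hp.segment (show j + (j' - j) ≤ l by omega) hS
  have := hQ _ _ (by omega) hseg ?_ ?_ (i - j) (by omega)
  · refine hpi fun hv => ?_
    convert this using 1
    exact Subtype.ext (congrArg p (by omega))
  · simpa using hj hjN
  · have h := hj' hj'N
    convert h using 1
    exact Subtype.ext (congrArg p (by omega))

theorem CliqueFree.induce_neighborSet {n : ℕ} (h : G.CliqueFree (n + 1)) (u : V) :
    (G.induce (G.neighborSet u)).CliqueFree n := by
  classical
  intro t ht
  have h1 : G.IsNClique n (t.map (Function.Embedding.subtype _)) :=
    (ht.map (f := Function.Embedding.subtype _)).mono (map_comap_le _ _)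
  refine h _ (h1.insert (a := u) ?_)
  intro b hb
  obtain ⟨c, _, rfl⟩ := Finset.mem_map.1 hb
  exact c.2

theorem exists_stable_step {α : Type*} {K : ℕ} {E : ℕ → Set α} (hE : ∀ j, E (j + 1) ⊆ E j)
    (hK : (E 0).encard ≤ K) : ∃ j ≤ K, E (j + 1) = E j := by
  by_contra hcon
  push Not at hcon
  have hfin : ∀ j, (E j).Finite := by
    intro j
    induction j with
    | zero => exact Set.finite_of_encard_le_coe hK
    | succ j ih => exact ih.subset (hE j)
  have hlt : ∀ j ≤ K + 1, (E j).ncard + j ≤ K := by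
    intro j
    induction j with
    | zero =>
      intro _
      rw [← (hfin 0).cast_ncard_eq] at hK
      exact_mod_cast hK
    | succ j ih =>
      intro hj
      have := Set.ncard_lt_ncard ((hE j).ssubset_of_ne (hcon j (by omega))) (hfin j)
      have := ih (by omega)
      omega
  have := hlt (K + 1) le_rfl
  omega

theorem PathGenerated.exists_mem_walkBall (hG : ∀ N, G.ChordalUpTo N) {m k : ℕ} (hm : 1 ≤ m)
    {P : Set V} (hPk : P.encard ≤ k) (hP : G.PathGenerated m P) (x : V) :
    ∃ p ∈ P, p ∈ G.walkBall x ((k * k + 1) * m + 1) := by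
  by_contra hcon
  push Not at hcon
  -- Pairs of generators connected outside the ball of radius `j * m + 1` decrease with `j`. There
  -- are at most `k * k` pairs, so some enlargement of the radius by `m` separates no further pair.
  obtain ⟨j, hjk, hj⟩ := exists_stable_step (K := k * k)
    (E := fun j => {e : V × V | e ∈ P ×ˢ P ∧
      (G.within (G.walkBall x (j * m + 1))ᶜ).Reachable e.1 e.2})
    (fun j e he => ⟨he.1, he.2.mono (within_mono (Set.compl_subset_compl.2
      (walkBall_mono x (by rw [add_mul]; omega))))⟩)
    ((Set.encard_le_encard (t := P ×ˢ P) fun e he => he.1).trans (by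
      rw [Set.encard_prod]
      push_cast
      gcongr))
  obtain ⟨r, hr⟩ : ∃ r, r = j * m := ⟨_, rfl⟩
  obtain ⟨s, hs⟩ : ∃ s, s = (j + 1) * m := ⟨_, rfl⟩
  have hsr : s = r + m := by rw [hs, hr, add_mul, one_mul]
  rw [← hr, ← hs] at hj
  have hPs : ∀ p ∈ P, p ∉ G.walkBall x (s + 1) := fun p hp h => hcon p hp
    (walkBall_mono x (by rw [hs]; gcongr) h)
  set D := (G.walkBall x (s + 1))ᶜ with hD
  -- The exterior `D` with its neighbours contains `P`; once shown path-closed it must contain `x`,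
  -- which is absurd.
  have hx : x ∈ {y | ∃ z ∈ D, y = z ∨ G.Adj y z} := by
    refine hP {y | ∃ z ∈ D, y = z ∨ G.Adj y z} (fun p hp => ⟨p, hPs p hp, Or.inl rfl⟩) ?_ x
    have hQ : ∀ y ∈ {y | ∃ z ∈ D, y = z ∨ G.Adj y z}, y ∉ G.walkBall x s ∧
        ∃ a ∈ P, ∃ z ∈ D, (G.within D).Reachable z a ∧ (y = z ∨ G.Adj y z) := by
      rintro y ⟨z, hz, hyz⟩
      obtain ⟨a, ha, hza⟩ := hP.exists_reachable hG hz
      refine ⟨fun hy => hz ?_, a, ha, z, hz, hza, hyz⟩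
      rcases hyz with rfl | h
      · exact walkBall_mono x (Nat.le_succ s) hy
      · exact mem_walkBall_succ_of_adj hy h
    intro p l hlm hp h0 hl i hi
    obtain ⟨h0s, a, ha, z, hz, hza, h0z⟩ := hQ _ h0
    obtain ⟨hls, b, hb, z', hz', hzb, hlz⟩ := hQ _ hl
    have hDr : D ⊆ (G.walkBall x (r + 1))ᶜ :=
      Set.compl_subset_compl.2 (walkBall_mono x (by omega))
    have hadj : ∀ t, t + 1 ≤ l → G.Adj (p t) (p (t + 1)) :=
      fun t ht => (hp t (t + 1) (by omega) ht).2.2 rfl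
    -- The ends lie outside the ball of radius `s = r + m`, and a path of length at most `m` is too
    -- short to dip into radius `r + 1`.
    have hout : ∀ t ≤ l, p t ∉ G.walkBall x (r + 1) := by
      intro t ht hball
      have hdown : ∀ d ≤ t, p (t - d) ∈ G.walkBall x (r + 1 + d) := by
        intro d
        induction d with
        | zero => exact fun _ => hball
        | succ d ih =>
          intro hd
          refine mem_walkBall_succ_of_adj (ih (by omega)) ?_
          have := hadj (t - (d + 1)) (by omega)
          rw [show t - (d + 1) + 1 = t - d by omega] at this
          exact this.symm
      have hup : ∀ d, t + d ≤ l → p (t + d) ∈ G.walkBall x (r + 1 + d) := by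
        intro d
        induction d with
        | zero => exact fun _ => hball
        | succ d ih =>
          intro hd
          exact mem_walkBall_succ_of_adj (ih (by omega)) (hadj (t + d) (by omega))
      rcases Nat.lt_or_ge t m with h | h
      · have := hdown t le_rfl
        rw [Nat.sub_self] at this
        exact h0s (walkBall_mono x (by omega) this)
      · have := hup (l - t) (by omega)
        rw [show t + (l - t) = l by omega] at this
        exact hls (walkBall_mono x (by omega) this)
    have hreach : ∀ t ≤ l, (G.within (G.walkBall x (r + 1))ᶜ).Reachable (p 0) (p t) := by
      intro t
      induction t with
      | zero => exact fun _ => Reachable.refl _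
      | succ t ih =>
        intro ht
        exact (ih (by omega)).trans
          (reachable_within_of_adj (hadj t ht) (hout t (by omega)) (hout (t + 1) ht))
    have hlink : ∀ t ≤ l, ∀ z ∈ D, (p t = z ∨ G.Adj (p t) z) →
        (G.within (G.walkBall x (r + 1))ᶜ).Reachable (p t) z := by
      rintro t ht z hz (h | h)
      · rw [h]
      · exact reachable_within_of_adj h (hout t ht) (hDr hz)
    have hmono := within_mono (G := G) hDr
    have hab : (G.within (G.walkBall x (r + 1))ᶜ).Reachable a b :=
      (hza.mono hmono).symm.trans ((hlink 0 (by omega) z hz h0z).symm.trans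
        ((hreach l le_rfl).trans ((hlink l le_rfl z' hz' hlz).trans (hzb.mono hmono))))
    -- By stability both ends attach to one component of `D`; that component with its neighbours is
    -- path-closed.
    have hab' : (G.within D).Reachable a b := by
      have : ((a, b) : V × V) ∈ {e : V × V | e ∈ P ×ˢ P ∧ (G.within D).Reachable e.1 e.2} := by
        rw [hj]
        exact ⟨⟨ha, hb⟩, hab⟩
      exact this.2
    have haD : ∀ c, (G.within D).Reachable a c → c ∈ D :=
      fun c hc => mem_of_reachable_within (hPs a ha) hc
    have hclosed : G.PathClosed m {y | ∃ c, (G.within D).Reachable a c ∧ (y = c ∨ G.Adj y c)} := by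
      refine pathClosed_of_boundary ?_
      have hb : ∀ q ∈ {y | ∃ c, (G.within D).Reachable a c ∧ (y = c ∨ G.Adj y c)},
          ∀ y ∉ {y | ∃ c, (G.within D).Reachable a c ∧ (y = c ∨ G.Adj y c)}, G.Adj q y →
          q ∈ G.walkBall x (s + 1) ∧ ∃ c, (G.within D).Reachable a c ∧ G.Adj q c := by
        rintro q ⟨c, hc, hqc⟩ y hy hqy
        have hqC : ¬ (G.within D).Reachable a q := fun h => hy ⟨q, h, Or.inr hqy.symm⟩
        have hqc' : G.Adj q c := by
          rcases hqc with rfl | h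
          · exact absurd hc hqC
          · exact h
        refine ⟨?_, c, hc, hqc'⟩
        by_contra hq
        exact hqC (hc.trans (reachable_within_of_adj hqc'.symm (haD c hc) hq))
      intro q hq q' hq' hne y hy y' hy' h h'
      obtain ⟨hqb, c, hc, hqc⟩ := hb q hq y hy h
      obtain ⟨hqb', c', hc', hqc'⟩ := hb q' hq' y' hy' h'
      exact adj_of_adj_component hG (hPs a ha) hne hqb hqb' hc hc' hqc hqc'
    obtain ⟨c, hc, hic⟩ := hclosed p l hlm hp ⟨z, hza.symm, h0z⟩
      ⟨z', hab'.trans hzb.symm, hlz⟩ i hi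
    exact ⟨c, haD c hc, hic⟩
  obtain ⟨z, hz, h | h⟩ := hx
  · exact hz (h ▸ mem_walkBall_self _ _)
  · exact hz (mem_walkBall_succ_of_adj (mem_walkBall_self _ _) h)

/-- In chordal graphs of bounded clique number, the closure of a set under chordless paths of
bounded length is bounded in terms of the size of the set. -/
theorem exists_bound_of_pathGenerated (m : ℕ) (hm : 1 ≤ m) (w : ℕ) : ∀ k : ℕ, ∃ F : ℕ,
    ∀ (V : Type*) (G : SimpleGraph V), (∀ N, G.ChordalUpTo N) → G.CliqueFree (w + 1) →
      ∀ P : Set V, P.encard ≤ k → G.PathGenerated m P → (Set.univ : Set V).encard ≤ F := by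
  induction w with
  | zero =>
    intro k
    refine ⟨0, fun V G _ hfree P _ _ => ?_⟩
    have : IsEmpty V := cliqueFree_one.1 hfree
    rw [Set.univ_eq_empty_iff.2 this, Set.encard_empty]
    exact zero_le
  | succ w ih =>
    intro k
    -- A neighbourhood has at most `k` generators from `P` and `k * (w + 2)` border vertices.
    obtain ⟨d, hd⟩ := ih (k + k * (w + 1 + 1))
    refine ⟨k * (d + 1) ^ ((k * k + 1) * m + 1), fun V G hG hfree P hPk hP => ?_⟩
    have hdeg : ∀ u, (G.neighborSet u).encard ≤ d := by
      intro u
      have h := hd _ (G.induce (G.neighborSet u)) (fun N => (hG N).induce _)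
        (hfree.induce_neighborSet u) _ ?_ (hP.induce_neighborSet u)
      · rwa [Set.encard_univ, ENat.card_coe_set_eq] at h
      · rw [← Subtype.val_injective.encard_image]
        refine (Set.encard_le_encard (t := P ∪
          {z | z ∈ G.walkBall u 1 ∧ ∃ y ∉ G.walkBall u 1, G.Adj z y}) ?_).trans
          ((Set.encard_union_le _ _).trans ?_)
        · rintro _ ⟨z, hz | hz, rfl⟩
          · exact Or.inl hz
          · exact Or.inr ⟨mem_walkBall_one.2 (Or.inr z.2), hz⟩
        · push_cast
          gcongr
          exact_mod_cast hP.encard_border_le hG hfree hPk u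
    refine (Set.encard_le_encard ?_).trans (Set.encard_biUnion_le_mul hPk
      fun p _ => encard_walkBall_le hdeg _ p)
    intro x _
    obtain ⟨p, hp, h⟩ := hP.exists_mem_walkBall hG hm hPk x
    exact Set.mem_biUnion hp (mem_walkBall_comm.1 h)

/-! ### From full chordality to chordality up to `N` -/

theorem ChordalUpTo.of_ncard_le {N : ℕ} (hG : G.ChordalUpTo N) {S : Set V} (hS : S.Finite)
    (hN : S.ncard ≤ N) (M : ℕ) : (G.induce S).ChordalUpTo M := by
  intro c n h4 _ hc
  refine hG _ n h4 ?_ hc.of_induce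
  refine le_trans ?_ hN
  have hinj : Function.Injective (fun i : Fin n => (c i : V)) := by
    intro i j hij
    rcases lt_trichotomy i j with h | h | h
    · exact absurd (Subtype.ext hij) (hc i j h j.2).1
    · exact h
    · exact absurd (Subtype.ext hij.symm) (hc j i h i.2).1
  have h1 : (Set.range fun i : Fin n => (c i : V)).ncard = n := by
    rw [← Set.image_univ, Set.ncard_image_of_injective _ hinj]
    simp
  rw [← h1]
  refine Set.ncard_le_ncard ?_ hS
  rintro _ ⟨i, rfl⟩
  exact (c i).2

/-- A generated set of size at most `F` that is not closed gains at most `m + 1` vertices from a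
missing path. It still has at most `N` vertices, hence is fully chordal, and `hF` returns it to size
at most `F`. Strict growth cannot continue. -/
theorem exists_pathClosed_superset {m F N : ℕ} {P : Set V} (hPfin : P.Finite)
    (hG : G.ChordalUpTo N) (hN : F + m + 1 ≤ N) (hPN : P.ncard ≤ N)
    (hF : ∀ S : Set V, (∀ M, (G.induce S).ChordalUpTo M) →
      (G.induce S).PathGenerated m (Subtype.val ⁻¹' P) → S.encard ≤ F) :
    ∃ Q, P ⊆ Q ∧ G.PathClosed m Q ∧ Q.encard ≤ F := by
  by_contra hcon
  push Not at hcon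
  have hgrow : ∀ n : ℕ, ∃ S : Set V, P ⊆ S ∧ S.encard ≤ F ∧
      (G.induce S).PathGenerated m (Subtype.val ⁻¹' P) ∧ (n : ℕ∞) ≤ S.encard := by
    intro n
    induction n with
    | zero =>
      have hgen : (G.induce P).PathGenerated m (Subtype.val ⁻¹' P) :=
        fun Q hQ _ x => hQ x.2
      exact ⟨P, subset_rfl, hF P (hG.of_ncard_le hPfin hPN) hgen, hgen, by simp⟩
    | succ n ih =>
      obtain ⟨S, hPS, hSF, hgen, hn⟩ := ih
      have hSfin : S.Finite := Set.finite_of_encard_le_coe hSF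
      have hnc : ¬ G.PathClosed m S := fun h => (not_lt.2 hSF) (hcon S hPS h)
      simp only [PathClosed, not_forall] at hnc
      obtain ⟨p, l, hlm, hp, h0, hl, i, hi, hpi⟩ := hnc
      obtain ⟨T, hT⟩ : ∃ T, T = S ∪ p '' Set.Iic l := ⟨_, rfl⟩
      have hST : S ⊆ T := hT ▸ Set.subset_union_left
      have hpT : ∀ t ≤ l, p t ∈ T := fun t ht => hT ▸ Or.inr ⟨t, ht, rfl⟩
      have hTfin : T.Finite := hT ▸ hSfin.union ((Set.finite_Iic l).image p)
      have hTcard : T.ncard ≤ N := by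
        have h1 : S.ncard ≤ F := by
          rw [← hSfin.cast_ncard_eq] at hSF
          exact_mod_cast hSF
        have h2 : (p '' Set.Iic l).ncard ≤ l + 1 := by
          refine (Set.ncard_image_le (Set.finite_Iic l)).trans ?_
          simp [Set.ncard_eq_toFinset_card']
        have h3 := Set.ncard_union_le S (p '' Set.Iic l)
        rw [← hT] at h3
        omega
      have hgenT : (G.induce T).PathGenerated m (Subtype.val ⁻¹' P) := by
        intro Q hPQ hQ
        have hSQ : ∀ x (hx : x ∈ S), (⟨x, hST hx⟩ : T) ∈ Q := by
          intro x hx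
          refine hgen {y | (⟨y, hST y.2⟩ : T) ∈ Q} (fun y hy => hPQ hy) ?_ ⟨x, hx⟩
          intro q b hbm hq hq0 hqb a hab
          exact hQ (fun t => ⟨q t, hST (q t).2⟩) b hbm
            (fun i j hij hj =>
              ⟨fun h => (hq i j hij hj).1 (Subtype.ext (congrArg (fun v : T => (v : V)) h)),
              (hq i j hij hj).2⟩) hq0 hqb a hab
        have hpQ : ∀ t (ht : t ≤ l), (⟨p t, hpT t ht⟩ : T) ∈ Q := by
          intro t ht
          have hseg := hp.segment (S := T) (j := 0) (k := l) (by omega)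
            (fun t ht => by simpa using hpT t ht)
          have := hQ _ l hlm hseg (by simpa using hSQ _ h0) (by simpa using hSQ _ hl) t ht
          simpa [ht] using this
        rintro ⟨x, hx⟩
        have hx' := hx
        rw [hT] at hx'
        rcases hx' with h | ⟨t, ht, rfl⟩
        · exact hSQ x h
        · exact hpQ t ht
      refine ⟨T, hPS.trans hST, hF T (hG.of_ncard_le hTfin hTcard) hgenT,
        hgenT, ?_⟩
      have hlt : S.encard < T.encard :=
        hSfin.encard_lt_encard ⟨hST, fun h => hpi (h (hpT i hi))⟩
      push_cast
      exact (add_le_add_left hn 1).trans (Order.add_one_le_of_lt hlt)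
  obtain ⟨S, _, hSF, _, hn⟩ := hgrow (F + 1)
  have := hn.trans hSF
  have h' : F + 1 ≤ F := by exact_mod_cast this
  omega

end Bound

end SimpleGraph

/-! ### The intersection graph of cosets -/

namespace CayleyGroup

section CosetGraph

variable {E : Type*} {G : Type*} [Group G] {C : CayleyGroup E G}

theorem mem_coset_self (v : G) (α : Set E) : v ∈ C.coset v α := by
  change v⁻¹ * v ∈ C.subgroup α
  rw [inv_mul_cancel]
  exact one_mem _

theorem coset_eq_of_mem {u v : G} {α : Set E} (h : u ∈ C.coset v α) :
    C.coset v α = C.coset u α := by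
  have h' : v⁻¹ * u ∈ C.subgroup α := h
  ext x
  change v⁻¹ * x ∈ C.subgroup α ↔ u⁻¹ * x ∈ C.subgroup α
  rw [← Subgroup.mul_mem_cancel_left _ (inv_mem h')]
  simp [mul_assoc]

theorem coset_mono {α β : Set E} (h : α ⊆ β) (v : G) : C.coset v α ⊆ C.coset v β :=
  fun _ hu => Subgroup.closure_mono (Set.image_mono h) hu

theorem coset_mem_cosets (v : G) (α : Set E) : C.coset v α ∈ C.cosets := ⟨v, α, rfl⟩

theorem nonempty_of_mem_cosets {X : Set G} (hX : X ∈ C.cosets) : X.Nonempty := by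
  obtain ⟨v, α, rfl⟩ := hX
  exact ⟨v, mem_coset_self v α⟩

theorem exists_eq_coset {X : Set G} (hX : X ∈ C.cosets) {x : G} (hx : x ∈ X) :
    ∃ α, X = C.coset x α := by
  obtain ⟨v, α, rfl⟩ := hX
  exact ⟨α, coset_eq_of_mem hx⟩

theorem CosetAcyclic.mono {n n' : ℕ} (hC : C.CosetAcyclic n) (h : n' ≤ n) : C.CosetAcyclic n' :=
  fun r hr => hC r (hr.trans h)

/-- A point `g` violating this yields the coset cycle `x, α, g, β` of length 2. -/
theorem CosetAcyclic.coset_inter (hC : C.CosetAcyclic 2) (x : G) (α β : Set E) :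
    C.coset x α ∩ C.coset x β = C.coset x (α ∩ β) := by
  refine Set.Subset.antisymm ?_
    (Set.subset_inter (coset_mono Set.inter_subset_left x) (coset_mono Set.inter_subset_right x))
  rintro g ⟨hα, hβ⟩
  by_contra hg
  have hdisj : C.coset x (α ∩ β) ∩ C.coset g (α ∩ β) = ∅ := by
    rw [← Set.disjoint_iff_inter_eq_empty, Set.disjoint_left]
    intro y hy hy'
    rw [coset_eq_of_mem hy, ← coset_eq_of_mem hy'] at hg
    exact hg (mem_coset_self _ _)
  have hβ' : g⁻¹ * x ∈ C.subgroup β := by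
    have := inv_mem (show x⁻¹ * g ∈ C.subgroup β from hβ)
    simpa using this
  refine hC 2 le_rfl (![x, g] : Fin 2 → G) (![α, β] : Fin 2 → Set E) ⟨by norm_num, ?_⟩
  intro i
  fin_cases i
  · refine ⟨hα, ?_⟩
    change C.coset x (β ∩ α) ∩ C.coset g (α ∩ β) = ∅
    rwa [Set.inter_comm β α]
  · refine ⟨hβ', ?_⟩
    change C.coset g (α ∩ β) ∩ C.coset x (β ∩ α) = ∅
    rwa [Set.inter_comm β α, Set.inter_comm]

theorem CosetAcyclic.inter_mem_cosets (hC : C.CosetAcyclic 2) {X Y : Set G} (hX : X ∈ C.cosets)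
    (hY : Y ∈ C.cosets) (hXY : (X ∩ Y).Nonempty) : X ∩ Y ∈ C.cosets := by
  obtain ⟨x, hx, hx'⟩ := hXY
  obtain ⟨α, rfl⟩ := exists_eq_coset hX hx
  obtain ⟨β, rfl⟩ := exists_eq_coset hY hx'
  rw [hC.coset_inter]
  exact coset_mem_cosets _ _

theorem CosetAcyclic.false_of_cyclic {n r : ℕ} (hC : C.CosetAcyclic n) (h1 : 1 ≤ r) (hr : r ≤ n)
    (X : ZMod r → Set G) (hX : ∀ i, X i ∈ C.cosets) (h : ∀ i, (X i ∩ X (i + 1)).Nonempty)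
    (h3 : ∀ i, X (i - 1) ∩ X i ∩ X (i + 1) = ∅) : False := by
  choose u hu hu' using h
  have hv : ∀ i, u (i - 1) ∈ X i := fun i => by
    have := hu' (i - 1)
    rwa [sub_add_cancel] at this
  choose α hα using fun i => exists_eq_coset (hX i) (hv i)
  have hα' : ∀ i, X i = C.coset (u i) (α i) := fun i =>
    (hα i).trans (coset_eq_of_mem (by rw [← hα i]; exact hu i))
  -- The shift places the `i`-th vertex in `X (i - 1) ∩ X i`.
  refine hC r hr (fun i => u (i - 1)) α ⟨h1, fun i => ⟨?_, ?_⟩⟩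
  · have h := hu i
    rw [hα i] at h
    change (u (i - 1))⁻¹ * u (i + 1 - 1) ∈ C.subgroup (α i)
    rw [add_sub_cancel_right]
    exact h
  · rw [← Set.subset_empty_iff, ← h3 i]
    rintro y ⟨hy, hy'⟩
    refine ⟨⟨?_, ?_⟩, ?_⟩
    · rw [hα' (i - 1)]
      exact coset_mono Set.inter_subset_left _ hy
    · rw [hα i]
      exact coset_mono Set.inter_subset_right _ hy
    · rw [hα (i + 1)]
      exact coset_mono Set.inter_subset_right _ hy'

theorem CosetAcyclic.inter_inter_nonempty (hC : C.CosetAcyclic 3) {X Y Z : Set G}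
    (hX : X ∈ C.cosets) (hY : Y ∈ C.cosets) (hZ : Z ∈ C.cosets) (hXY : (X ∩ Y).Nonempty)
    (hYZ : (Y ∩ Z).Nonempty) (hXZ : (X ∩ Z).Nonempty) : (X ∩ Y ∩ Z).Nonempty := by
  by_contra hne
  rw [Set.not_nonempty_iff_eq_empty] at hne
  refine hC.false_of_cyclic (r := 3) (by norm_num) le_rfl (![X, Y, Z] : Fin 3 → Set G) ?_ ?_ ?_
  · intro i
    fin_cases i <;> assumption
  · intro i
    fin_cases i
    · exact hXY
    · exact hYZ
    · exact Set.inter_comm X Z ▸ hXZ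
  · intro i
    fin_cases i
    · change Z ∩ X ∩ Y = ∅
      rw [← hne]
      ext
      simp only [Set.mem_inter_iff]
      tauto
    · exact hne
    · change Y ∩ Z ∩ X = ∅
      rw [← hne]
      ext
      simp only [Set.mem_inter_iff]
      tauto

/-- Helly property. The distinguished coset `Y` absorbs members of `s` one by one: `Y ∩ X` is again
a coset, and it meets the others by the case of three cosets. -/
theorem CosetAcyclic.exists_mem_of_pairwise (hC : C.CosetAcyclic 3) (s : Finset (Set G)) :
    ∀ Y ∈ C.cosets, (∀ X ∈ s, X ∈ C.cosets) → (∀ X ∈ s, ∀ Z ∈ s, (X ∩ Z).Nonempty) →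
      (∀ X ∈ s, (Y ∩ X).Nonempty) → ∃ x ∈ Y, ∀ X ∈ s, x ∈ X := by
  classical
  induction s using Finset.induction_on with
  | empty =>
    intro Y hY _ _ _
    obtain ⟨x, hx⟩ := nonempty_of_mem_cosets hY
    exact ⟨x, hx, by simp⟩
  | insert X s _ ih =>
    intro Y hY hs hss hYs
    simp only [Finset.forall_mem_insert] at hs hss hYs
    obtain ⟨x, hx, hxs⟩ := ih (Y ∩ X) ((hC.mono (by norm_num)).inter_mem_cosets hY hs.1 hYs.1) hs.2
      (fun A hA => (hss.2 A hA).2)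
      (fun A hA => hC.inter_inter_nonempty hY hs.1 (hs.2 A hA) hYs.1 (hss.1.2 A hA) (hYs.2 A hA))
    exact ⟨x, hx.1, by simpa using ⟨hx.2, hxs⟩⟩

variable (C) in
/-- Two cosets are adjacent if they are distinct and intersect. -/
def cosetGraph : SimpleGraph (Set G) where
  Adj X Y := X ≠ Y ∧ X ∈ C.cosets ∧ Y ∈ C.cosets ∧ (X ∩ Y).Nonempty
  symm := ⟨fun _ _ h => ⟨h.1.symm, h.2.2.1, h.2.1, Set.inter_comm _ _ ▸ h.2.2.2⟩⟩
  loopless := ⟨fun _ h => h.1 rfl⟩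

/-- A clique has a common point `x`, and each coset through `x` is determined by its label set. -/
theorem CosetAcyclic.cliqueFree_cosetGraph [Finite E] (hC : C.CosetAcyclic 3) :
    C.cosetGraph.CliqueFree (Nat.card (Set E) + 1) := by
  intro s hs
  have hpos : 0 < Nat.card (Set E) := Nat.card_pos
  have hadj : ∀ X ∈ s, ∀ Y ∈ s, X ≠ Y → C.cosetGraph.Adj X Y := fun X hX Y hY => hs.1 hX hY
  have hcos : ∀ X ∈ s, X ∈ C.cosets := by
    intro X hX
    obtain ⟨Y, hY, hne⟩ := Finset.exists_mem_ne (by rw [hs.2]; omega) X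
    exact (hadj X hX Y hY hne.symm).2.1
  have hint : ∀ X ∈ s, ∀ Y ∈ s, (X ∩ Y).Nonempty := by
    intro X hX Y hY
    by_cases h : X = Y
    · rw [← h, Set.inter_self]
      exact nonempty_of_mem_cosets (hcos X hX)
    · exact (hadj X hX Y hY h).2.2.2
  obtain ⟨X₀, hX₀⟩ : s.Nonempty := Finset.card_pos.1 (by rw [hs.2]; omega)
  obtain ⟨x, -, hx⟩ := hC.exists_mem_of_pairwise s X₀ (hcos _ hX₀) hcos hint (hint X₀ hX₀)
  have hsub : (s : Set (Set G)) ⊆ Set.range (C.coset x) := by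
    intro X hX
    obtain ⟨α, hα⟩ := exists_eq_coset (hcos X hX) (hx X hX)
    exact ⟨α, hα.symm⟩
  have h1 := Set.ncard_le_ncard hsub (Set.finite_range _)
  rw [Set.ncard_coe_finset, hs.2] at h1
  have h2 : (Set.range (C.coset x)).ncard ≤ Nat.card (Set E) := by
    rw [← Set.image_univ, ← Set.ncard_univ]
    exact Set.ncard_image_le Set.finite_univ
  omega

/-- In a chordless cycle of length at least 4 the two neighbours of a vertex are disjoint cosets, so
triple intersections vanish and a coset cycle results. -/
theorem CosetAcyclic.chordalUpTo_cosetGraph {N : ℕ} (hC : C.CosetAcyclic N) :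
    C.cosetGraph.ChordalUpTo N := by
  intro c n h4 hn hc
  have : NeZero n := ⟨by omega⟩
  have hval : ∀ i : ZMod n, ((i + 1).val = i.val + 1 ∧ i.val + 1 < n) ∨
      ((i + 1).val = 0 ∧ i.val + 1 = n) := by
    intro i
    have h1 : (i + 1).val = (i.val + 1) % n := by
      rw [ZMod.val_add, ZMod.val_one_eq_one_mod, Nat.add_mod_mod]
    have h2 := ZMod.val_lt i
    rcases Nat.lt_or_ge (i.val + 1) n with h | h
    · exact Or.inl ⟨by rw [h1, Nat.mod_eq_of_lt h], h⟩
    · have h3 : i.val + 1 = n := by omega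
      exact Or.inr ⟨by rw [h1, h3, Nat.mod_self], h3⟩
  have hadj : ∀ i : ZMod n, C.cosetGraph.Adj (c i.val) (c (i + 1).val) := by
    intro i
    rcases hval i with ⟨h, h'⟩ | ⟨h, h'⟩
    · rw [h]
      exact (hc _ _ (by omega) h').2.2 (Or.inl rfl)
    · rw [h]
      exact ((hc 0 i.val (by omega) (by omega)).2.2 (Or.inr ⟨rfl, h'⟩)).symm
  refine hC.false_of_cyclic (by omega) hn (fun i => c i.val) (fun i => (hadj i).2.1)
    (fun i => (hadj i).2.2.2) fun i => ?_
  have hnon : c (i - 1).val ≠ c (i + 1).val ∧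
      ¬ C.cosetGraph.Adj (c (i - 1).val) (c (i + 1).val) := by
    have h1 := hval (i - 1)
    rw [sub_add_cancel] at h1
    have h2 := hval i
    have h3 := ZMod.val_lt (i - 1)
    rcases lt_trichotomy (i - 1).val (i + 1).val with h | h | h
    · have := hc _ _ h (by omega)
      exact ⟨this.1, fun h' => by have := this.2.1 h'; omega⟩
    · omega
    · have := hc _ _ h (by omega)
      exact ⟨this.1.symm, fun h' => by have := this.2.1 h'.symm; omega⟩
  rw [← Set.not_nonempty_iff_eq_empty]
  rintro ⟨y, ⟨hy, _⟩, hy'⟩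
  exact hnon.2 ⟨hnon.1, (hadj _).2.1, (hadj _).2.1, y, hy, hy'⟩

theorem CosetAcyclic.isInducedPath_of_isCosetPath {N : ℕ} (hC : C.CosetAcyclic N) (h3 : 3 ≤ N)
    {l : ℕ} (hl : l ≤ N) {v : ℕ → G} {α : ℕ → Set E} (h : C.IsCosetPath l v α) :
    C.cosetGraph.IsInducedPath (fun t => C.coset (v (t + 1)) (α (t + 1))) (l - 1) := by
  obtain ⟨-, -, -, hpath⟩ := h
  have hC2 := hC.mono (show 2 ≤ N by omega)
  obtain ⟨X, hX⟩ : ∃ X : ℕ → Set G, X = fun t => C.coset (v (t + 1)) (α (t + 1)) := ⟨_, rfl⟩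
  rw [← hX]
  have hXc : ∀ t, X t ∈ C.cosets := fun t => hX ▸ coset_mem_cosets _ _
  have hinter : ∀ t, t + 1 < l →
      X t ∩ X (t + 1) = C.coset (v (t + 2)) (α (t + 1) ∩ α (t + 2)) := by
    intro t ht
    rw [← hC2.coset_inter, hX]
    dsimp only
    rw [coset_eq_of_mem (hpath (t + 1) (by omega) (by omega)).1]
  have hcons : ∀ t, t + 1 < l → C.cosetGraph.Adj (X t) (X (t + 1)) := by
    intro t ht
    refine ⟨fun heq => ?_, hXc _, hXc _, ?_⟩
    · have h1 := (hpath (t + 1) (by omega) (by omega)).2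
      have h2 := hinter t ht
      rw [← heq, Set.inter_self] at h2
      refine Set.notMem_empty (v (t + 1)) (h1 ▸ ⟨mem_coset_self _ _, ?_⟩)
      change v (t + 1) ∈ C.coset (v (t + 2)) (α (t + 1) ∩ α (t + 2))
      rw [← h2, hX]
      exact mem_coset_self _ _
    · rw [hinter t ht]
      exact ⟨_, mem_coset_self _ _⟩
  -- At distance two the three-coset Helly property contradicts the path condition. At larger
  -- distance, a closest meeting pair closes a chordless cycle of length `d + 3`.
  have hfar : ∀ d i, i + d + 2 < l → ¬ (X i ∩ X (i + d + 2)).Nonempty := by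
    intro d
    induction d using Nat.strong_induction_on with
    | _ d ih =>
      intro i hi hne
      rcases Nat.eq_zero_or_pos d with rfl | hd
      · have h1 := (hC.mono h3).inter_inter_nonempty (hXc i) (hXc (i + 1)) (hXc (i + 2))
          (hcons i (by omega)).2.2.2 (hcons (i + 1) (by omega)).2.2.2 hne
        have h2 := (hpath (i + 2) (by omega) (by omega)).2
        obtain ⟨y, ⟨hy, hy'⟩, hy''⟩ := h1
        refine Set.notMem_empty y (h2 ▸ ⟨?_, ?_⟩)
        · exact (hinter i (by omega)) ▸ (⟨hy, hy'⟩ : y ∈ X i ∩ X (i + 1))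
        · exact (hinter (i + 1) (by omega)) ▸ (⟨hy', hy''⟩ : y ∈ X (i + 1) ∩ X (i + 1 + 1))
      · refine hC.chordalUpTo_cosetGraph (fun t => X (i + t)) (d + 3) (by omega) (by omega) ?_
        intro a b hab hb
        dsimp only
        by_cases h1 : b = a + 1
        · have := hcons (i + a) (by omega)
          rw [h1]
          exact ⟨this.1, iff_of_true this (Or.inl rfl)⟩
        by_cases h2 : a = 0 ∧ b + 1 = d + 3
        · obtain ⟨rfl, h2⟩ := h2
          have hb' : i + b = i + d + 2 := by omega
          rw [hb', add_zero]
          have hne' : X i ≠ X (i + d + 2) := by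
            intro heq
            have h4 := (hcons i (by omega)).2.2.2
            rw [heq, Set.inter_comm] at h4
            have h5 := ih (d - 1) (by omega) (i + 1) (by omega)
            rw [show i + 1 + (d - 1) + 2 = i + d + 2 by omega] at h5
            exact h5 h4
          exact ⟨hne', iff_of_true ⟨hne', hXc _, hXc _, hne⟩ (Or.inr ⟨rfl, h2⟩)⟩
        · have h5 := ih (b - a - 2) (by omega) (i + a) (by omega)
          rw [show i + a + (b - a - 2) + 2 = i + b by omega] at h5
          refine ⟨fun heq => h5 ?_, iff_of_false (fun h => h5 h.2.2.2) (by omega)⟩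
          rw [heq, Set.inter_self]
          exact nonempty_of_mem_cosets (hXc _)
  intro i j hij hj
  by_cases h1 : j = i + 1
  · have := hcons i (by omega)
    rw [h1]
    exact ⟨this.1, iff_of_true this rfl⟩
  · have h5 := hfar (j - i - 2) i (by omega)
    rw [show i + (j - i - 2) + 2 = j by omega] at h5
    refine ⟨fun heq => h5 ?_, iff_of_false (fun h => h5 h.2.2.2) h1⟩
    rw [heq, Set.inter_self]
    exact nonempty_of_mem_cosets (hXc _)

theorem CosetAcyclic.isMClosed_of_pathClosed {m N : ℕ} (hC : C.CosetAcyclic N) (h3 : 3 ≤ N)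
    (hm : m ≤ N) {Q : Set (Set G)} (hQ : C.cosetGraph.PathClosed m Q) :
    C.IsMClosed m (Q ∩ C.cosets) := by
  intro l v α hl hpath h1 h2 i hi hil
  refine ⟨?_, coset_mem_cosets _ _⟩
  -- A coset path of length `l` has `l` cosets, hence `l - 1` edges; its end coset is that of `v l`.
  have hlast : C.coset (v l) (α l) = C.coset (v (l + 1)) (α l) :=
    coset_eq_of_mem (hpath.2.2.2 l hpath.1 le_rfl).1
  have := hQ _ (l - 1) (by omega)
    (hC.isInducedPath_of_isCosetPath h3 (hl.trans hm) hpath) h1.1 ?_ (i - 1) (by omega)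
  · simpa [show i - 1 + 1 = i by omega] using this
  · rw [show l - 1 + 1 = l by omega, hlast]
    exact h2.1

end CosetGraph

end CayleyGroup

/-! ### The bound for the convex closure -/

theorem mainTheorem5 {E : Type*} [Finite E] (m : ℕ) (hm : 1 ≤ m) :
    ∃ f N : ℕ → ℕ, ∀ (k : ℕ) (G : Type*) [Group G] (C : CayleyGroup E G),
      C.CosetAcyclic (N k) →
        ∀ P : Set (Set G), P ⊆ C.cosets → P.encard ≤ (k : ℕ∞) →
          (C.convexClosure m P).encard ≤ (f k : ℕ∞) := by
  choose F hF using SimpleGraph.exists_bound_of_pathGenerated m hm (Nat.card (Set E))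
  -- `F k + m + 1` covers a set enlarged by one path, `k` covers `P` itself, and `3` the Helly
  -- property.
  refine ⟨F, fun k => F k + m + 1 + k + 3, fun k G _ C hC P hP hPk => ?_⟩
  obtain ⟨M, hM⟩ : ∃ M, M = F k + m + 1 + k + 3 := ⟨_, rfl⟩
  replace hC : C.CosetAcyclic M := hM ▸ hC
  have hPfin : P.Finite := Set.finite_of_encard_le_coe hPk
  have hPcard : P.ncard ≤ k := by
    rw [← hPfin.cast_ncard_eq] at hPk
    exact_mod_cast hPk
  obtain ⟨Q, hPQ, hQ, hQF⟩ := SimpleGraph.exists_pathClosed_superset (F := F k) (m := m) hPfin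
    hC.chordalUpTo_cosetGraph (by omega) (by omega) fun S hS hgen => by
      have h := hF k S (C.cosetGraph.induce S) hS
        ((SimpleGraph.cliqueFree_induce_iff _ _ _).2
          ((hC.mono (show 3 ≤ M by omega)).cliqueFree_cosetGraph.cliqueFreeOn)) _ ?_ hgen
      · rwa [Set.encard_univ, ENat.card_coe_set_eq] at h
      · rw [← Subtype.val_injective.encard_image]
        exact (Set.encard_le_encard (Set.image_preimage_subset _ _)).trans hPk
  refine (Set.encard_le_encard ?_).trans hQF
  exact fun X hX => (Set.mem_sInter.1 hX (Q ∩ C.cosets) ⟨Set.subset_inter hPQ hP,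
    Set.inter_subset_right, hC.isMClosed_of_pathClosed (by omega) (by omega) hQ⟩).1
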